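/- Let $m\ge 1$, let $\lambda_1,\dots,\lambda_m$ be points of the open unit disk, not all equal to $0$, let $|\gamma|=1$, and let $$B(z)=\gamma\prod_{j=1}^m\frac{z-\lambda_j}{1-\overline{\lambda_j}\,z}$$ be the corresponding finite Blaschke product. For $n\ge1$ and $k\ge 0$ put $$\widehat{B^n}(k)=\frac1{2\pi}\int_0^{2\pi}B^n(e^{i\theta})e^{-ik\theta}\,d\theta .$$ Let $\psi_B:\mathbb R\to\mathbb R$ be a continuous argument of $B$ on the circle, that is, a continuous function with $B(e^{i\theta})=e^{i\psi_B(\theta)}$ for all $\theta$ (such a function exists). Then $\psi_B''$ has finitely many zeros $0\le\xi_1<\dots<\xi_s<2\pi$ on $[0,2\pi)$, with $s\ge1$, and each has finite multiplicity. Write the multiplicity of $\xi_\ell$ as a zero of $\psi_B''$ as $N_\ell-2$, so that $N_\ell\ge3$, $\psi_B^{(j)}(\xi_\ell)=0$ for $2\le j\le N_\ell-1$ and $\psi_B^{(N_\ell)}(\xi_\ell)\ne0$. Put $N=\max_{1\le\ell\le s}N_\ell\ge3$. Then there are constants $c,C>0$, depending only on $B$, such that for all integers $n\ge1$ $$c\,n^{-1/N}\le\sup_{k\ge0}\bigl|\widehat{B^n}(k)\bigr|\le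 C\,n^{-1/N}.$$ -/

import Mathlib

/-- The Blaschke factor `b_a(z) = (z - a) / (1 - conj a * z)`. -/
noncomputable def blaschkeFactor (a z : ℂ) : ℂ :=
  (z - a) / (1 - (starRingEnd ℂ) a * z)

/-- The finite Blaschke product of degree `m` with zeros `a 0, …, a (m - 1)` (repeated according
to multiplicity) and unimodular constant factor `γ`. -/
noncomputable def blaschkeProduct {m : ℕ} (γ : ℂ) (a : Fin m → ℂ) (z : ℂ) : ℂ :=
  γ * ∏ j, blaschkeFactor (a j) z

/-- The `k`-th Fourier coefficient of the restriction of `f` to the unit circle. -/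
noncomputable def circleFourierCoeff (f : ℂ → ℂ) (k : ℕ) : ℂ :=
  (1 / (2 * (Real.pi : ℂ))) *
    ∫ θ in (0 : ℝ)..(2 * Real.pi),
      f (Complex.exp (Complex.I * θ)) * Complex.exp (-(Complex.I * k * θ))

/-- `sup_{k ≥ 0} |f̂(k)|`. -/
noncomputable def fourierSupNorm (f : ℂ → ℂ) : ℝ :=
  ⨆ k : ℕ, ‖circleFourierCoeff f k‖

/-- `ψ` is a continuous argument of `f` along the unit circle: `f (e^{iθ}) = e^{i ψ(θ)}`. -/
def IsContinuousArgument (f : ℂ → ℂ) (ψ : ℝ → ℝ) : Prop :=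
  Continuous ψ ∧
    ∀ θ : ℝ, f (Complex.exp (Complex.I * θ)) = Complex.exp (Complex.I * ψ θ)

/-- `ξ 0 < ξ 1 < …` are exactly the zeros of `ψ''` on `[0, 2π)`, and the zero `ξ ℓ` of `ψ''` has
(finite) multiplicity `N ℓ - 2 ≥ 1`. -/
structure IsInflectionData (ψ : ℝ → ℝ) {s : ℕ} (ξ : Fin s → ℝ) (N : Fin s → ℕ) : Prop where
  strictMono : StrictMono ξ
  range_eq : Set.range ξ = {θ | θ ∈ Set.Ico 0 (2 * Real.pi) ∧ iteratedDeriv 2 ψ θ = 0}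
  three_le : ∀ l, 3 ≤ N l
  vanish : ∀ l, ∀ j, 2 ≤ j → j < N l → iteratedDeriv j ψ (ξ l) = 0
  ne_zero : ∀ l, iteratedDeriv (N l) ψ (ξ l) ≠ 0

/-! On the circle `B^n = e^{inψ}`, so its coefficients are oscillatory integrals with phase `nψ(θ) -
kθ`. Derivatives of the phase of order at least two do not see `k`, and this makes the estimates
uniform in `k`.

Upper bound: at each point of `[0, 2π]` some derivative of `ψ` of order `j` with `2 ≤ j ≤ N` is
nonzero. Van der Corput's lemma (`exists_norm_integral_exp_le`) gives `O(n^{-1/j})`, hence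
`O(n^{-1/N})`, near that point, and compactness leaves finitely many pieces
(`exists_norm_integral_phase_le`).

Lower bound: let `ξ` be a zero of `ψ''` with `N_ℓ = N`, and let `k` be the integer nearest to
`nψ'(ξ)`. By Taylor the phase moves by at most `1` on a window of radius `δ ~ n^{-1/N}` about `ξ`.
The kernel `|∑_{p<M} e^{ipu}|²` with `M ~ 1/δ` has mass `2πM`, mostly inside the window, so the
integral against it is at least of order `M` (`exists_le_norm_integral_phase`). Expanded, the same
integral is a sum of `M²` Fourier integrals of `B^n` (`norm_integral_mul_fejerWeight_le`); negative
frequencies contribute zero because `B^n` is holomorphic. Hence the supremum is at least of order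
`1/M ~ n^{-1/N}`.

The inflection data exist because `ψ` is real-analytic and `ψ''` is not identically zero: otherwise
`B` would be a monomial. They are nonempty by Rolle applied to the periodic `ψ'`. -/

/-! ### The argument of a finite Blaschke product -/

open Complex in
/-- An explicit real-analytic argument of a finite Blaschke product on the unit circle. -/
noncomputable def blaschkeArgument {m : ℕ} (γ : ℂ) (a : Fin m → ℂ) (θ : ℝ) : ℝ :=
  γ.arg + ∑ j, (θ - 2 * (log (1 - (starRingEnd ℂ) (a j) * exp (I * θ))).im)

theorem norm_conj_mul_exp_lt_one {a : ℂ} (ha : ‖a‖ < 1) (θ : ℝ) :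
    ‖(starRingEnd ℂ) a * Complex.exp (Complex.I * θ)‖ < 1 := by
  rw [norm_mul, mul_comm Complex.I, Complex.norm_exp_ofReal_mul_I, mul_one]
  simpa using ha

theorem one_sub_mem_slitPlane {w : ℂ} (hw : ‖w‖ < 1) : 1 - w ∈ Complex.slitPlane := by
  left
  have := (Complex.re_le_norm w).trans_lt hw
  simpa using this

/-- With `w = 1 - conj a * e^{iθ}`, the factor equals `e^{iθ} * conj w / w`, and `conj w / w =
e^{-2i arg w}`. -/
theorem blaschkeFactor_exp {a : ℂ} (ha : ‖a‖ < 1) (θ : ℝ) :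
    blaschkeFactor a (Complex.exp (Complex.I * θ)) =
      Complex.exp (Complex.I * ((θ - 2 * (Complex.log
        (1 - (starRingEnd ℂ) a * Complex.exp (Complex.I * θ))).im : ℝ) : ℂ)) := by
  set w := 1 - (starRingEnd ℂ) a * Complex.exp (Complex.I * θ) with hw
  have hw0 : w ≠ 0 :=
    Complex.slitPlane_ne_zero (one_sub_mem_slitPlane (norm_conj_mul_exp_lt_one ha θ))
  have h1 : Complex.I * ((θ - 2 * (Complex.log w).im : ℝ) : ℂ) =
      Complex.I * θ + (starRingEnd ℂ) (Complex.log w) - Complex.log w := by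
    have := Complex.sub_conj (Complex.log w)
    push_cast at this ⊢
    linear_combination this
  rw [h1, Complex.exp_sub, Complex.exp_add, Complex.exp_log hw0, Complex.exp_conj,
    Complex.exp_log hw0, blaschkeFactor, ← hw]
  congr 1
  have h2 : Complex.exp (Complex.I * θ) * Complex.exp (-(Complex.I * θ)) = 1 := by
    rw [← Complex.exp_add]; simp
  have h3 : (starRingEnd ℂ) (Complex.exp (Complex.I * θ)) = Complex.exp (-(Complex.I * θ)) := by
    rw [← Complex.exp_conj]; simp
  rw [hw]
  simp only [map_sub, map_one, map_mul, Complex.conj_conj, h3]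
  linear_combination a * h2

theorem exp_blaschkeArgument {m : ℕ} {γ : ℂ} (hγ : ‖γ‖ = 1) {a : Fin m → ℂ}
    (ha : ∀ j, ‖a j‖ < 1) (θ : ℝ) :
    blaschkeProduct γ a (Complex.exp (Complex.I * θ)) =
      Complex.exp (Complex.I * blaschkeArgument γ a θ) := by
  have hγ' : γ = Complex.exp (Complex.I * γ.arg) := by
    have := Complex.norm_mul_exp_arg_mul_I γ
    rw [hγ, Complex.ofReal_one, one_mul, mul_comm] at this
    exact this.symm
  rw [blaschkeProduct, blaschkeArgument, Complex.ofReal_add, mul_add, Complex.exp_add, ← hγ',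
    Complex.ofReal_sum, Finset.mul_sum, Complex.exp_sum]
  congr 1
  exact Finset.prod_congr rfl fun j _ => blaschkeFactor_exp (ha j) θ

theorem analyticAt_blaschkeArgument {m : ℕ} (γ : ℂ) {a : Fin m → ℂ}
    (ha : ∀ j, ‖a j‖ < 1) (θ : ℝ) : AnalyticAt ℝ (blaschkeArgument γ a) θ := by
  unfold blaschkeArgument
  refine analyticAt_const.add (Finset.analyticAt_fun_sum _ fun j _ => ?_)
  refine analyticAt_id.sub (analyticAt_const.mul ?_)
  have hE : AnalyticAt ℝ (fun θ : ℝ => 1 - (starRingEnd ℂ) (a j) * Complex.exp (Complex.I * θ)) θ := by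
    have h1 : AnalyticAt ℝ (fun θ : ℝ => (θ : ℂ)) θ := Complex.ofRealCLM.analyticAt θ
    have h2 : AnalyticAt ℝ (fun z : ℂ => 1 - (starRingEnd ℂ) (a j) * Complex.exp (Complex.I * z)) θ := by
      have : AnalyticAt ℂ (fun z : ℂ => 1 - (starRingEnd ℂ) (a j) * Complex.exp (Complex.I * z)) θ := by
        fun_prop
      exact this.restrictScalars
    exact h2.comp h1
  have hlog : AnalyticAt ℝ Complex.log (1 - (starRingEnd ℂ) (a j) * Complex.exp (Complex.I * θ)) :=
    (analyticAt_clog (one_sub_mem_slitPlane (norm_conj_mul_exp_lt_one (ha j) θ))).restrictScalars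
  exact (Complex.imCLM.analyticAt _).comp
    (hlog.comp (f := fun θ : ℝ => 1 - (starRingEnd ℂ) (a j) * Complex.exp (Complex.I * θ)) hE)

theorem exp_I_mul_add_two_pi (θ : ℝ) :
    Complex.exp (Complex.I * ((θ + 2 * Real.pi : ℝ) : ℂ)) = Complex.exp (Complex.I * θ) := by
  rw [show Complex.I * ((θ + 2 * Real.pi : ℝ) : ℂ) =
    Complex.I * θ + 2 * Real.pi * Complex.I by push_cast; ring, Complex.exp_add,
    Complex.exp_two_pi_mul_I, mul_one]

theorem blaschkeArgument_add_two_pi {m : ℕ} (γ : ℂ) (a : Fin m → ℂ) (θ : ℝ) :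
    blaschkeArgument γ a (θ + 2 * Real.pi) = blaschkeArgument γ a θ + 2 * Real.pi * m := by
  unfold blaschkeArgument
  rw [exp_I_mul_add_two_pi]
  simp only [Finset.sum_sub_distrib, Finset.sum_add_distrib, Finset.sum_const, Finset.card_univ,
    Fintype.card_fin, nsmul_eq_mul]
  ring

/-- The difference divided by `2π` is continuous and integer-valued, hence constant. -/
theorem eq_add_const_of_exp_eq {f g : ℝ → ℝ} (hf : Continuous f) (hg : Continuous g)
    (h : ∀ θ : ℝ, Complex.exp (Complex.I * f θ) = Complex.exp (Complex.I * g θ)) :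
    ∃ c, ∀ θ, f θ = g θ + c := by
  have hint : ∀ θ, ∃ n : ℤ, f θ = g θ + n * (2 * Real.pi) := fun θ => by
    obtain ⟨n, hn⟩ := Complex.exp_eq_exp_iff_exists_int.1 (h θ)
    refine ⟨n, ?_⟩
    have h2 : Complex.I * (f θ : ℂ) = Complex.I * ((g θ + n * (2 * Real.pi) : ℝ) : ℂ) := by
      rw [hn]; push_cast; ring
    exact_mod_cast mul_left_cancel₀ Complex.I_ne_zero h2
  choose n hn using hint
  have hnc : Continuous n := by
    have h3 : Continuous fun θ => ((n θ : ℤ) : ℝ) := by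
      have : (fun θ => ((n θ : ℤ) : ℝ)) = fun θ => (f θ - g θ) / (2 * Real.pi) := by
        funext θ
        rw [hn θ]
        field_simp
        ring
      rw [this]
      fun_prop
    exact Int.isClosedEmbedding_coe_real.isEmbedding.continuous_iff.2 h3
  refine ⟨n 0 * (2 * Real.pi), fun θ => ?_⟩
  have : n θ = n 0 := (PreconnectedSpace.constant inferInstance hnc)
  rw [hn θ, this]

theorem IsContinuousArgument.eq_blaschkeArgument_add_const {m : ℕ} {γ : ℂ} (hγ : ‖γ‖ = 1)
    {a : Fin m → ℂ} (ha : ∀ j, ‖a j‖ < 1) {ψ : ℝ → ℝ}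
    (hψ : IsContinuousArgument (blaschkeProduct γ a) ψ) :
    ∃ c, ψ = fun θ => blaschkeArgument γ a θ + c := by
  obtain ⟨c, hc⟩ := eq_add_const_of_exp_eq hψ.1
    (continuous_iff_continuousAt.2 fun θ => (analyticAt_blaschkeArgument γ ha θ).continuousAt)
    (fun θ => by rw [← hψ.2 θ, exp_blaschkeArgument hγ ha])
  exact ⟨c, funext hc⟩

theorem IsContinuousArgument.analyticOnNhd {m : ℕ} {γ : ℂ} (hγ : ‖γ‖ = 1)
    {a : Fin m → ℂ} (ha : ∀ j, ‖a j‖ < 1) {ψ : ℝ → ℝ}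
    (hψ : IsContinuousArgument (blaschkeProduct γ a) ψ) : AnalyticOnNhd ℝ ψ Set.univ := by
  obtain ⟨c, rfl⟩ := hψ.eq_blaschkeArgument_add_const hγ ha
  exact fun θ _ => (analyticAt_blaschkeArgument γ ha θ).add analyticAt_const

theorem IsContinuousArgument.add_two_pi {m : ℕ} {γ : ℂ} (hγ : ‖γ‖ = 1)
    {a : Fin m → ℂ} (ha : ∀ j, ‖a j‖ < 1) {ψ : ℝ → ℝ}
    (hψ : IsContinuousArgument (blaschkeProduct γ a) ψ) (θ : ℝ) :
    ψ (θ + 2 * Real.pi) = ψ θ + 2 * Real.pi * m := by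
  obtain ⟨c, rfl⟩ := hψ.eq_blaschkeArgument_add_const hγ ha
  simp only [blaschkeArgument_add_two_pi]
  ring

theorem infinite_range_exp_I_mul :
    (Set.range fun θ : ℝ => Complex.exp (Complex.I * θ)).Infinite := by
  refine Set.infinite_of_injective_forall_mem
    (f := fun n : ℕ => Complex.exp (Complex.I * ((1 / ((n : ℝ) + 1) : ℝ) : ℂ))) ?_
    fun n => ⟨_, rfl⟩
  intro p q hpq
  have key : ∀ n : ℕ, 0 < 1 / ((n : ℝ) + 1) ∧ 1 / ((n : ℝ) + 1) ≤ 1 := fun n => by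
    refine ⟨by positivity, ?_⟩
    rw [div_le_one (by positivity)]
    linarith [(Nat.cast_nonneg n : (0 : ℝ) ≤ n)]
  have hpi := Real.pi_gt_three
  have := Complex.exp_inj_of_neg_pi_lt_of_le_pi (x := Complex.I * ((1 / ((p : ℝ) + 1) : ℝ) : ℂ))
    (y := Complex.I * ((1 / ((q : ℝ) + 1) : ℝ) : ℂ))
    (by rw [Complex.I_mul_im, Complex.ofReal_re]; linarith [key p])
    (by rw [Complex.I_mul_im, Complex.ofReal_re]; linarith [key p])
    (by rw [Complex.I_mul_im, Complex.ofReal_re]; linarith [key q])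
    (by rw [Complex.I_mul_im, Complex.ofReal_re]; linarith [key q]) hpq
  have h2 := Complex.ofReal_injective (mul_left_cancel₀ Complex.I_ne_zero this)
  have h3 : (p : ℝ) + 1 = q + 1 := by
    simpa using h2
  exact_mod_cast add_right_cancel h3

open Polynomial in
-- Clearing denominators gives a polynomial identity at infinitely many points, hence everywhere. At
-- a nonzero `a j` the left side vanishes and the right side does not.
theorem blaschkeProduct_not_monomial {m : ℕ} {γ : ℂ} {a : Fin m → ℂ}
    (ha : ∀ j, ‖a j‖ < 1) (ha0 : ∃ j, a j ≠ 0) {κ : ℂ} (hκ : κ ≠ 0) :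
    ¬ ∀ θ : ℝ, blaschkeProduct γ a (Complex.exp (Complex.I * θ)) =
      κ * Complex.exp (Complex.I * θ) ^ m := by
  intro h
  obtain ⟨j, hj⟩ := ha0
  let P : ℂ[X] := C γ * ∏ j, (X - C (a j))
  let Q : ℂ[X] := C κ * X ^ m * ∏ j, (1 - C ((starRingEnd ℂ) (a j)) * X)
  have hPQ : P = Q := by
    refine Polynomial.eq_of_infinite_eval_eq P Q (infinite_range_exp_I_mul.mono ?_)
    rintro _ ⟨θ, rfl⟩
    have hθ := h θ
    have hne : ∏ j, (1 - (starRingEnd ℂ) (a j) * Complex.exp (Complex.I * θ)) ≠ 0 :=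
      Finset.prod_ne_zero_iff.2 fun j _ =>
        Complex.slitPlane_ne_zero (one_sub_mem_slitPlane (norm_conj_mul_exp_lt_one (ha j) θ))
    simp only [blaschkeProduct, blaschkeFactor, Finset.prod_div_distrib] at hθ
    rw [← mul_div_assoc, div_eq_iff hne] at hθ
    simpa [P, Q, eval_prod] using hθ
  have hP : P.eval (a j) = 0 := by
    simp only [P, eval_mul, eval_prod]
    rw [Finset.prod_eq_zero (Finset.mem_univ j) (by simp), mul_zero]
  have hQ : Q.eval (a j) ≠ 0 := by
    simp only [Q, eval_mul, eval_prod, eval_C, eval_pow, eval_X]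
    refine mul_ne_zero (mul_ne_zero hκ (pow_ne_zero _ hj)) (Finset.prod_ne_zero_iff.2 fun i _ => ?_)
    have hlt : ‖(starRingEnd ℂ) (a i) * a j‖ < 1 := by
      rw [norm_mul, RCLike.norm_conj]
      exact mul_lt_one_of_nonneg_of_lt_one_left (norm_nonneg _) (ha i) (ha j).le
    simpa using Complex.slitPlane_ne_zero (one_sub_mem_slitPlane hlt)
  exact hQ (hPQ ▸ hP)

/-! ### Van der Corput estimates -/

/-- Integration by parts: `e^{iφ}` is the derivative of `-i e^{iφ} / d` minus `i e^{iφ} d' / d²`.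
Since `d' ≥ 0`, the norm of the last term is `(-1/d)'`, whose integral telescopes; boundary and
remainder give `2/t` each. -/
theorem norm_integral_exp_le_of_le_deriv {φ d d' : ℝ → ℝ} (hd1 : ∀ x, HasDerivAt φ (d x) x)
    (hd2 : ∀ x, HasDerivAt d (d' x) x) (hc2 : Continuous d') {a b t : ℝ}
    (hab : a ≤ b) (ht : 0 < t) (h1 : ∀ x ∈ Set.Icc a b, t ≤ |d x|)
    (h2 : ∀ x ∈ Set.Icc a b, 0 ≤ d' x) :
    ‖∫ x in a..b, Complex.exp (Complex.I * φ x)‖ ≤ 4 / t := by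
  have hne : ∀ x ∈ Set.uIcc a b, d x ≠ 0 := fun x hx h0 => by
    have := h1 x (Set.uIcc_of_le hab ▸ hx)
    rw [h0, abs_zero] at this
    linarith
  have hcφ : Continuous φ := continuous_iff_continuousAt.2 fun x => (hd1 x).continuousAt
  have hc1 : Continuous d := continuous_iff_continuousAt.2 fun x => (hd2 x).continuousAt
  let E : ℝ → ℂ := fun x => Complex.exp (Complex.I * φ x)
  have hcE : Continuous E := by fun_prop
  have hnE : ∀ x, ‖E x‖ = 1 := fun x => by
    simp only [E]; rw [mul_comm, Complex.norm_exp_ofReal_mul_I]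
  have hdr : ∀ x ∈ Set.uIcc a b,
      HasDerivAt (fun x => -(d x)⁻¹) (d' x / (d x) ^ 2) x :=
    fun x hx => by
      exact ((hd2 x).fun_inv (hne x hx)).fun_neg.congr_deriv (by rw [neg_div, neg_neg])
  have hcr : ContinuousOn (fun x => d' x / (d x) ^ 2) (Set.uIcc a b) :=
    hc2.continuousOn.div (hc1.pow 2).continuousOn fun x hx => pow_ne_zero 2 (hne x hx)
  have hdF : ∀ x ∈ Set.uIcc a b,
      HasDerivAt (fun x => E x * (-Complex.I * (((d x)⁻¹ : ℝ) : ℂ)))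
        (E x + E x * (Complex.I * ((d' x / (d x) ^ 2 : ℝ) : ℂ))) x := by
    intro x hx
    have hE : HasDerivAt E (E x * (Complex.I * (d x : ℂ))) x :=
      ((hd1 x).ofReal_comp.const_mul Complex.I).cexp
    have hG : HasDerivAt (fun x => -Complex.I * (((d x)⁻¹ : ℝ) : ℂ))
        (Complex.I * ((d' x / (d x) ^ 2 : ℝ) : ℂ)) x := by
      refine ((hdr x hx).ofReal_comp.const_mul Complex.I).congr_of_eventuallyEq
        (Filter.Eventually.of_forall fun y => ?_)
      push_cast
      ring
    refine (hE.fun_mul hG).congr_deriv ?_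
    congr 1
    have h0 : (d x : ℂ) ≠ 0 := by exact_mod_cast hne x hx
    push_cast
    field_simp
    rw [Complex.I_sq]
    ring
  have hcR : ContinuousOn
      (fun x => E x * (Complex.I * ((d' x / (d x) ^ 2 : ℝ) : ℂ)))
      (Set.uIcc a b) :=
    hcE.continuousOn.mul (continuousOn_const.mul (Complex.continuous_ofReal.comp_continuousOn hcr))
  have hFTC := intervalIntegral.integral_eq_sub_of_hasDerivAt hdF
    (hcE.continuousOn.add hcR).intervalIntegrable
  rw [intervalIntegral.integral_add hcE.continuousOn.intervalIntegrable hcR.intervalIntegrable]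
    at hFTC
  have hinv : ∀ x ∈ Set.Icc a b, |(d x)⁻¹| ≤ 1 / t := fun x hx => by
    rw [abs_inv, one_div]
    exact inv_anti₀ ht (h1 x hx)
  have ha := hinv a ⟨le_rfl, hab⟩
  have hb := hinv b ⟨hab, le_rfl⟩
  have hR : ‖∫ x in a..b, E x * (Complex.I *
      ((d' x / (d x) ^ 2 : ℝ) : ℂ))‖ ≤ 2 / t := by
    have := intervalIntegral.norm_integral_le_of_norm_le (μ := MeasureTheory.volume) hab
      (f := fun x => E x * (Complex.I * ((d' x / (d x) ^ 2 : ℝ) : ℂ)))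
      (g := fun x => d' x / (d x) ^ 2)
      (Filter.Eventually.of_forall fun x hx => by
        rw [norm_mul, hnE, norm_mul, Complex.norm_I, Complex.norm_real, Real.norm_eq_abs,
          abs_of_nonneg (div_nonneg (h2 x ⟨hx.1.le, hx.2⟩) (sq_nonneg _))]
        simp)
      hcr.intervalIntegrable
    rw [intervalIntegral.integral_eq_sub_of_hasDerivAt hdr hcr.intervalIntegrable] at this
    refine this.trans ?_
    have h3 := neg_abs_le (d b)⁻¹
    have h4 := le_abs_self (d a)⁻¹
    have : 2 / t = 1 / t + 1 / t := by ring
    linarith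
  have hbd : ∀ x ∈ Set.Icc a b, ‖E x * (-Complex.I * (((d x)⁻¹ : ℝ) : ℂ))‖ ≤ 1 / t :=
    fun x hx => by
      rw [norm_mul, hnE, norm_mul, norm_neg, Complex.norm_I, Complex.norm_real, Real.norm_eq_abs]
      simpa using hinv x hx
  have hba := hbd a ⟨le_rfl, hab⟩
  have hbb := hbd b ⟨hab, le_rfl⟩
  have hmain : ∫ x in a..b, Complex.exp (Complex.I * φ x) =
      E b * (-Complex.I * (((d b)⁻¹ : ℝ) : ℂ)) - E a * (-Complex.I * (((d a)⁻¹ : ℝ) : ℂ))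
      - ∫ x in a..b, E x * (Complex.I * ((d' x / (d x) ^ 2 : ℝ) : ℂ)) :=
    eq_sub_of_add_eq hFTC
  rw [hmain]
  have e1 := norm_sub_le (E b * (-Complex.I * (((d b)⁻¹ : ℝ) : ℂ)) -
    E a * (-Complex.I * (((d a)⁻¹ : ℝ) : ℂ)))
    (∫ x in a..b, E x * (Complex.I * ((d' x / (d x) ^ 2 : ℝ) : ℂ)))
  have e2 := norm_sub_le (E b * (-Complex.I * (((d b)⁻¹ : ℝ) : ℂ)))
    (E a * (-Complex.I * (((d a)⁻¹ : ℝ) : ℂ)))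
  have e3 : 4 / t = 1 / t + 1 / t + 2 / t := by ring
  linarith

/-- Splitting an interval at a point where a function with large derivative is small. -/
theorem norm_integral_le_of_le_deriv {f : ℝ → ℂ} (hf : Continuous f) (hf1 : ∀ x, ‖f x‖ ≤ 1)
    {g g' : ℝ → ℝ} {a b μ δ K : ℝ} (hab : a ≤ b) (hμ : 0 < μ) (hδ : 0 < δ) (hK : 0 ≤ K)
    (hg : ∀ x, HasDerivAt g (g' x) x) (hg' : ∀ x ∈ Set.Icc a b, μ ≤ g' x)
    (hpos : ∀ u v, a ≤ u → u ≤ v → v ≤ b → (∀ x ∈ Set.Icc u v, μ * δ ≤ g x) →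
      ‖∫ x in u..v, f x‖ ≤ K)
    (hneg : ∀ u v, a ≤ u → u ≤ v → v ≤ b → (∀ x ∈ Set.Icc u v, g x ≤ -(μ * δ)) →
      ‖∫ x in u..v, f x‖ ≤ K) :
    ‖∫ x in a..b, f x‖ ≤ 2 * K + 2 * δ := by
  have hmono : ∀ x ∈ Set.Icc a b, ∀ y ∈ Set.Icc a b, x ≤ y → μ * (y - x) ≤ g y - g x :=
    fun x hx y hy hxy => (convex_Icc a b).mul_sub_le_image_sub_of_le_deriv
      (fun z _ => (hg z).continuousAt.continuousWithinAt)
      (fun z _ => (hg z).differentiableAt.differentiableWithinAt)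
      (fun z hz => by rw [(hg z).deriv]; exact hg' z (interior_subset hz)) x hx y hy hxy
  have hcont : Continuous g := continuous_iff_continuousAt.2 fun x => (hg x).continuousAt
  -- `c` is a zero of the increasing `g`, or the endpoint where `g` comes closest to zero. Growth at
  -- rate `μ` then forces `|g| ≥ μδ` at distance at least `δ` from `c`.
  obtain ⟨c, hc, hcl, hcr⟩ : ∃ c ∈ Set.Icc a b, (a < c → g c ≤ 0) ∧ (c < b → 0 ≤ g c) := by
    by_cases h1 : 0 ≤ g a
    · exact ⟨a, ⟨le_rfl, hab⟩, fun h => absurd h (lt_irrefl _), fun _ => h1⟩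
    by_cases h2 : g b ≤ 0
    · exact ⟨b, ⟨hab, le_rfl⟩, fun _ => h2, fun h => absurd h (lt_irrefl _)⟩
    obtain ⟨c, hc, hc0⟩ := intermediate_value_Icc hab hcont.continuousOn
      (⟨(not_le.1 h1).le, (not_le.1 h2).le⟩ : (0 : ℝ) ∈ Set.Icc (g a) (g b))
    exact ⟨c, hc, fun _ => hc0.le, fun _ => hc0.ge⟩
  set p := max a (c - δ)
  set q := min b (c + δ)
  have hap : a ≤ p := le_max_left _ _
  have hpc : p ≤ c := max_le hc.1 (by linarith)
  have hcq : c ≤ q := le_min hc.2 (by linarith)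
  have hqb : q ≤ b := min_le_left _ _
  have hpq : q - p ≤ 2 * δ := by
    have h1 : c - δ ≤ p := le_max_right _ _
    have h2 : q ≤ c + δ := min_le_right _ _
    linarith
  have hI : ∀ u v, IntervalIntegrable f MeasureTheory.volume u v := fun u v =>
    hf.intervalIntegrable u v
  have hleft : ‖∫ x in a..p, f x‖ ≤ K := by
    rcases le_total a (c - δ) with h | h
    · have hp : p = c - δ := max_eq_right h
      refine hneg a p le_rfl hap (hpc.trans hc.2) fun x hx => ?_
      have hxc : x ≤ c - δ := hp ▸ hx.2
      have := hmono x ⟨hx.1, by linarith [hc.2]⟩ c hc (by linarith)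
      have h5 := hcl (by linarith)
      nlinarith
    · have hp : p = a := max_eq_left h
      rw [hp, intervalIntegral.integral_same, norm_zero]
      exact hK
  have hright : ‖∫ x in q..b, f x‖ ≤ K := by
    rcases le_total b (c + δ) with h | h
    · have hq : q = b := min_eq_left h
      rw [hq, intervalIntegral.integral_same, norm_zero]
      exact hK
    · have hq : q = c + δ := min_eq_right h
      refine hpos q b (hc.1.trans hcq) hqb le_rfl fun x hx => ?_
      have hxc : c + δ ≤ x := hq ▸ hx.1
      have := hmono c hc x ⟨by linarith [hc.1], hx.2⟩ (by linarith)
      have h5 := hcr (by linarith)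
      nlinarith
  have hmid : ‖∫ x in p..q, f x‖ ≤ 2 * δ := by
    have := intervalIntegral.norm_integral_le_of_norm_le_const (a := p) (b := q) (f := f) (C := 1)
      fun x _ => hf1 x
    rw [one_mul, abs_of_nonneg (by linarith)] at this
    linarith
  rw [← intervalIntegral.integral_add_adjacent_intervals (hI a p) (hI p b),
    ← intervalIntegral.integral_add_adjacent_intervals (hI p q) (hI q b)]
  have e1 := norm_add_le (∫ x in a..p, f x) ((∫ x in p..q, f x) + ∫ x in q..b, f x)
  have e2 := norm_add_le (∫ x in p..q, f x) (∫ x in q..b, f x)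
  linarith

theorem norm_integral_exp_neg (φ : ℝ → ℝ) (a b : ℝ) :
    ‖∫ x in a..b, Complex.exp (Complex.I * ((-φ x : ℝ) : ℂ))‖ =
      ‖∫ x in a..b, Complex.exp (Complex.I * φ x)‖ := by
  have : ∀ x, Complex.exp (Complex.I * ((-φ x : ℝ) : ℂ)) =
      (starRingEnd ℂ) (Complex.exp (Complex.I * φ x)) := fun x => by
    rw [← Complex.exp_conj]
    simp
  simp_rw [this]
  rw [intervalIntegral.intervalIntegral_eq_integral_uIoc,
    intervalIntegral.intervalIntegral_eq_integral_uIoc, integral_conj, norm_smul, norm_smul,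
    RCLike.norm_conj]

/-- Van der Corput's lemma for derivatives of order at least two. -/
theorem exists_norm_integral_exp_le (j : ℕ) :
    ∃ C : ℝ, 0 ≤ C ∧ ∀ (φ : ℝ → ℝ), ContDiff ℝ (⊤ : ℕ∞) φ → ∀ a b t : ℝ, a ≤ b → 0 < t →
      (∀ x ∈ Set.Icc a b, t ^ (j + 2) ≤ iteratedDeriv (j + 2) φ x) →
      ‖∫ x in a..b, Complex.exp (Complex.I * φ x)‖ ≤ C / t := by
  have hder : ∀ (φ : ℝ → ℝ), ContDiff ℝ (⊤ : ℕ∞) φ → ∀ i x,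
      HasDerivAt (iteratedDeriv i φ) (iteratedDeriv (i + 1) φ x) x := fun φ hφ i x => by
    rw [iteratedDeriv_succ]
    exact (hφ.differentiable_iteratedDeriv i (by exact_mod_cast WithTop.coe_lt_top _) x).hasDerivAt
  have hcE : ∀ (φ : ℝ → ℝ), ContDiff ℝ (⊤ : ℕ∞) φ →
      Continuous fun x => Complex.exp (Complex.I * φ x) := fun φ hφ => by
    have := hφ.continuous
    fun_prop
  have hnE : ∀ (φ : ℝ → ℝ) (x : ℝ), ‖Complex.exp (Complex.I * φ x)‖ ≤ 1 := fun φ x => by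
    rw [mul_comm, Complex.norm_exp_ofReal_mul_I]
  induction j with
  | zero =>
    -- Here `μ = t²` and `δ = 1/t`, so `μδ = t` and the first-derivative bound `4/t` applies off the
    -- window: `2 * 4 + 2 = 10`.
    refine ⟨10, by norm_num, fun φ hφ a b t hab ht h => ?_⟩
    have hmul : t ^ 2 * (1 / t) = t := by field_simp
    have hsub : ∀ u v, a ≤ u → u ≤ v → v ≤ b → (∀ x ∈ Set.Icc u v, t ≤ |iteratedDeriv 1 φ x|) →
        ‖∫ x in u..v, Complex.exp (Complex.I * φ x)‖ ≤ 4 / t := fun u v hu huv hv hx =>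
      norm_integral_exp_le_of_le_deriv (fun x => by simpa using hder φ hφ 0 x) (hder φ hφ 1)
        ((contDiff_infty.1 hφ 2).continuous_iteratedDeriv 2 le_rfl) huv ht hx
        fun x hx => (sq_nonneg t).trans (h x ⟨hu.trans hx.1, hx.2.trans hv⟩)
    have := norm_integral_le_of_le_deriv (hcE φ hφ) (hnE φ) (g := iteratedDeriv 1 φ)
      (g' := iteratedDeriv 2 φ) hab (by positivity : 0 < t ^ 2) (by positivity : 0 < 1 / t)
      (by positivity : 0 ≤ 4 / t) (hder φ hφ 1) h
      (fun u v hu huv hv hx => hsub u v hu huv hv fun x hx' => by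
        have := hx x hx'
        rw [hmul] at this
        exact this.trans (le_abs_self _))
      (fun u v hu huv hv hx => hsub u v hu huv hv fun x hx' => by
        have := hx x hx'
        rw [hmul] at this
        exact (le_neg.1 this).trans (neg_le_abs _))
    refine this.trans (le_of_eq ?_)
    ring
  | succ j ih =>
    obtain ⟨C, hC, hCb⟩ := ih
    -- Again `δ = 1/t`: off the window the derivative one order lower is at least `t^(j+2)` in
    -- absolute value, with the same `t`. Where it is negative, `φ` is replaced by `-φ`, which
    -- conjugates the integral.
    refine ⟨2 * C + 2, by positivity, fun φ hφ a b t hab ht h => ?_⟩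
    have hmul : t ^ (j + 1 + 2) * (1 / t) = t ^ (j + 2) := by
      rw [show j + 1 + 2 = j + 2 + 1 from rfl, pow_succ]
      field_simp
    have := norm_integral_le_of_le_deriv (hcE φ hφ) (hnE φ) (g := iteratedDeriv (j + 2) φ)
      (g' := iteratedDeriv (j + 2 + 1) φ) hab (by positivity : 0 < t ^ (j + 1 + 2))
      (by positivity : 0 < 1 / t)
      (by positivity : 0 ≤ C / t) (hder φ hφ (j + 2)) h
      (fun u v hu huv hv hx => hCb φ hφ u v t huv ht fun x hx' => by
        have := hx x hx'
        rwa [hmul] at this)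
      (fun u v hu huv hv hx => by
        rw [← norm_integral_exp_neg]
        refine hCb (fun x => -φ x) hφ.neg u v t huv ht fun x hx' => ?_
        have := hx x hx'
        rw [hmul] at this
        rw [iteratedDeriv_fun_neg]
        linarith)
    refine this.trans (le_of_eq ?_)
    ring

/-! ### Zeros of the second derivative of the argument -/

theorem iteratedDeriv_add_period {ψ : ℝ → ℝ} {T K : ℝ} (h : ∀ θ, ψ (θ + T) = ψ θ + K) {j : ℕ}
    (hj : 0 < j) (θ : ℝ) : iteratedDeriv j ψ (θ + T) = iteratedDeriv j ψ θ := by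
  rw [← congrFun (iteratedDeriv_comp_add_const j ψ T) θ, ← iteratedDeriv_const_add (f := ψ) hj K]
  congr 1
  funext x
  rw [h, add_comm]

theorem iteratedDeriv_const_mul_sub_affine {ψ : ℝ → ℝ} (hψ : ContDiff ℝ (⊤ : ℕ∞) ψ) (c d e : ℝ)
    (j : ℕ) (θ : ℝ) :
    iteratedDeriv (j + 2) (fun x => c * ψ x - d * x - e) θ = c * iteratedDeriv (j + 2) ψ θ := by
  have h1 : deriv (fun x => c * ψ x - d * x - e) = fun x => c * deriv ψ x - d := by
    funext x
    have hx := (hψ.differentiable (by simp) x).hasDerivAt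
    simpa using (((hx.const_mul c).sub ((hasDerivAt_id x).const_mul d)).sub_const e).deriv
  have h2 : deriv (fun x => c * deriv ψ x - d) = fun x => c * deriv (deriv ψ) x := by
    funext x
    rw [deriv_sub_const, deriv_const_mul_field]
  rw [iteratedDeriv_succ', h1, iteratedDeriv_succ', h2, iteratedDeriv_const_mul_field,
    ← iteratedDeriv_succ', ← iteratedDeriv_succ']

/-- If `ψ'' = 0` identically, `ψ` is affine, with slope `m` because it gains `2πm` per turn. Then
`B` is a multiple of `z^m` on the circle. -/
theorem IsContinuousArgument.exists_iteratedDeriv_two_ne_zero {m : ℕ} {γ : ℂ} (hγ : ‖γ‖ = 1)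
    {a : Fin m → ℂ} (ha : ∀ j, ‖a j‖ < 1) (ha0 : ∃ j, a j ≠ 0) {ψ : ℝ → ℝ}
    (hψ : IsContinuousArgument (blaschkeProduct γ a) ψ) : ∃ θ, iteratedDeriv 2 ψ θ ≠ 0 := by
  by_contra! h
  have hC : ContDiff ℝ (⊤ : ℕ∞) ψ := (hψ.analyticOnNhd hγ ha).contDiff
  have hd : Differentiable ℝ ψ := hC.differentiable (by simp)
  have hd1 : Differentiable ℝ (deriv ψ) := by
    have := (contDiff_infty.1 hC 2).differentiable_iteratedDeriv 1 (by norm_num)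
    rwa [iteratedDeriv_one] at this
  have hd2 : ∀ x, deriv (deriv ψ) x = 0 := fun x => by
    rw [← iteratedDeriv_one (f := ψ), ← iteratedDeriv_succ]
    exact h x
  set κ := deriv ψ 0
  have h1 : ∀ x, deriv ψ x = κ := fun x => is_const_of_deriv_eq_zero hd1 hd2 x 0
  have h2 : ∀ x, ψ x - κ * x = ψ 0 := fun x => by
    have := is_const_of_deriv_eq_zero (f := fun x => ψ x - κ * x) (by fun_prop) (fun x => by
      have := ((hd x).hasDerivAt.fun_sub ((hasDerivAt_id x).const_mul κ)).deriv
      rw [h1] at this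
      simpa using this) x 0
    simpa using this
  have hκ : κ = m := by
    have h3 := hψ.add_two_pi hγ ha 0
    have h4 := h2 (0 + 2 * Real.pi)
    rw [h3, zero_add] at h4
    have h5 : (2 * Real.pi) * κ = (2 * Real.pi) * m := by linarith
    exact mul_left_cancel₀ (by positivity) h5
  refine blaschkeProduct_not_monomial (γ := γ) ha ha0
    (Complex.exp_ne_zero (Complex.I * ψ 0)) fun θ => ?_
  rw [hψ.2 θ, ← Complex.exp_nat_mul, ← Complex.exp_add]
  congr 1
  have h6 : ψ θ = ψ 0 + m * θ := by rw [← hκ]; linarith [h2 θ]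
  rw [h6]
  push_cast
  ring

theorem analyticOnNhd_iteratedDeriv {ψ : ℝ → ℝ} (hψ : AnalyticOnNhd ℝ ψ Set.univ) (j : ℕ) :
    AnalyticOnNhd ℝ (iteratedDeriv j ψ) Set.univ := by
  rw [iteratedDeriv_eq_iterate]
  exact hψ.iterated_deriv j

theorem finite_zeros_of_analyticOnNhd {g : ℝ → ℝ} (hg : AnalyticOnNhd ℝ g Set.univ)
    (h0 : ∃ θ, g θ ≠ 0) (b c : ℝ) : {θ | θ ∈ Set.Ico b c ∧ g θ = 0}.Finite := by
  by_contra hinf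
  obtain ⟨x, -, hx⟩ := Set.Infinite.exists_accPt_of_subset_isCompact hinf
    (isCompact_Icc (a := b) (b := c)) fun θ hθ => ⟨hθ.1.1, hθ.1.2.le⟩
  obtain ⟨θ, hθ⟩ := h0
  refine hθ (hg.eqOn_zero_of_preconnected_of_frequently_eq_zero isPreconnected_univ
    (Set.mem_univ x) ?_ (Set.mem_univ θ))
  rw [frequently_nhdsWithin_iff]
  exact (accPt_iff_frequently.1 hx).mono fun y hy => ⟨hy.2.2, hy.1⟩

/-- If all derivatives vanished at `x`, the analytic order there would be infinite and `g` would be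
zero. -/
theorem exists_iteratedDeriv_ne_zero {g : ℝ → ℝ} (hg : AnalyticOnNhd ℝ g Set.univ)
    (h0 : ∃ θ, g θ ≠ 0) (x : ℝ) : ∃ j, iteratedDeriv j g x ≠ 0 := by
  by_contra! h
  obtain ⟨θ, hθ⟩ := h0
  have htop : analyticOrderAt g x = ⊤ := ENat.eq_top_iff_forall_ge.2 fun n =>
    (natCast_le_analyticOrderAt_iff_iteratedDeriv_eq_zero (hg x (Set.mem_univ x))).2
      fun i _ => h i
  exact hθ (hg.eqOn_zero_of_preconnected_of_eventuallyEq_zero isPreconnected_univ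
    (Set.mem_univ x) (analyticOrderAt_eq_top.1 htop) (Set.mem_univ θ))

theorem exists_isInflectionData {ψ : ℝ → ℝ} (hψ : AnalyticOnNhd ℝ ψ Set.univ)
    (h0 : ∃ θ, iteratedDeriv 2 ψ θ ≠ 0) :
    ∃ (s : ℕ) (ξ : Fin s → ℝ) (N : Fin s → ℕ), IsInflectionData ψ ξ N := by
  classical
  have hg := analyticOnNhd_iteratedDeriv hψ 2
  have hfin := finite_zeros_of_analyticOnNhd hg h0 0 (2 * Real.pi)
  have hex : ∀ x, ∃ j, iteratedDeriv (j + 2) ψ x ≠ 0 := fun x => by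
    obtain ⟨j, hj⟩ := exists_iteratedDeriv_ne_zero hg h0 x
    refine ⟨j, ?_⟩
    rwa [iteratedDeriv_eq_iterate, iteratedDeriv_eq_iterate, ← Function.iterate_add_apply,
      ← iteratedDeriv_eq_iterate] at hj
  set ξ := hfin.toFinset.orderEmbOfFin rfl
  have hrange : Set.range ξ = {θ | θ ∈ Set.Ico 0 (2 * Real.pi) ∧ iteratedDeriv 2 ψ θ = 0} := by
    rw [Finset.range_orderEmbOfFin, Set.Finite.coe_toFinset]
  have hmem : ∀ l, iteratedDeriv 2 ψ (ξ l) = 0 := fun l =>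
    (hrange ▸ Set.mem_range_self l : ξ l ∈ {θ | _ ∧ _}).2
  refine ⟨_, ξ, fun l => Nat.find (hex (ξ l)) + 2, ξ.strictMono, hrange, fun l => ?_,
    fun l j hj hjl => ?_, fun l => Nat.find_spec (hex (ξ l))⟩
  · have : Nat.find (hex (ξ l)) ≠ 0 := fun h => by
      have h1 := Nat.find_spec (hex (ξ l))
      rw [h] at h1
      exact h1 (hmem l)
    omega
  · have := Nat.find_min (hex (ξ l)) (m := j - 2) (by omega)
    rwa [not_not, Nat.sub_add_cancel hj] at this

/-- Rolle's theorem for `ψ'`, which takes equal values at `0` and `2π`. -/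
theorem IsInflectionData.pos {ψ : ℝ → ℝ} (hψ : ContDiff ℝ (⊤ : ℕ∞) ψ) {K : ℝ}
    (hper : ∀ θ, ψ (θ + 2 * Real.pi) = ψ θ + K) {s : ℕ} {ξ : Fin s → ℝ} {N : Fin s → ℕ}
    (h : IsInflectionData ψ ξ N) : 0 < s := by
  have hc : Continuous (deriv ψ) := by
    have := (contDiff_infty.1 hψ 1).continuous_iteratedDeriv 1 le_rfl
    rwa [iteratedDeriv_one] at this
  have hp := iteratedDeriv_add_period hper one_pos 0
  rw [iteratedDeriv_one, zero_add] at hp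
  obtain ⟨c, hc, hc0⟩ := exists_deriv_eq_zero Real.two_pi_pos hc.continuousOn hp.symm
  rw [← iteratedDeriv_one (f := ψ), ← iteratedDeriv_succ] at hc0
  have : c ∈ Set.range ξ := h.range_eq ▸ ⟨⟨hc.1.le, hc.2⟩, hc0⟩
  obtain ⟨l, -⟩ := this
  exact l.pos

theorem IsInflectionData.exists_ne_zero {ψ : ℝ → ℝ} {K : ℝ}
    (hper : ∀ θ, ψ (θ + 2 * Real.pi) = ψ θ + K) {s : ℕ} {ξ : Fin s → ℝ} {N : Fin s → ℕ}
    (h : IsInflectionData ψ ξ N) {M : ℕ} (hM : 2 ≤ M) (hN : ∀ l, N l ≤ M) :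
    ∀ x ∈ Set.Icc 0 (2 * Real.pi), ∃ j, 2 ≤ j ∧ j ≤ M ∧ iteratedDeriv j ψ x ≠ 0 := by
  have key : ∀ x ∈ Set.Ico 0 (2 * Real.pi), ∃ j, 2 ≤ j ∧ j ≤ M ∧ iteratedDeriv j ψ x ≠ 0 := by
    intro x hx
    by_cases h0 : iteratedDeriv 2 ψ x = 0
    · obtain ⟨l, rfl⟩ : x ∈ Set.range ξ := h.range_eq ▸ ⟨hx, h0⟩
      exact ⟨N l, by linarith [h.three_le l], hN l, h.ne_zero l⟩
    · exact ⟨2, le_rfl, hM, h0⟩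
  intro x hx
  rcases hx.2.lt_or_eq with hlt | rfl
  · exact key x ⟨hx.1, hlt⟩
  · obtain ⟨j, hj, hjM, hj0⟩ := key 0 ⟨le_rfl, Real.two_pi_pos⟩
    refine ⟨j, hj, hjM, ?_⟩
    have := iteratedDeriv_add_period hper (by omega : 0 < j) 0
    rw [zero_add] at this
    rwa [this]

/-! ### Upper bound, uniform in the frequency -/

theorem exists_norm_integral_phase_le_of_le {N j : ℕ} (hj : 2 ≤ j) (hjN : j ≤ N) {r : ℝ}
    (hr : 0 < r) : ∃ C : ℝ, 0 ≤ C ∧ ∀ ψ : ℝ → ℝ, ContDiff ℝ (⊤ : ℕ∞) ψ → ∀ u v : ℝ, u ≤ v →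
      (∀ x ∈ Set.Icc u v, r ≤ iteratedDeriv j ψ x) → ∀ n : ℕ, 1 ≤ n → ∀ d : ℝ,
      ‖∫ x in u..v, Complex.exp (Complex.I * ((n * ψ x - d * x : ℝ) : ℂ))‖ ≤
        C * (n : ℝ) ^ (-(1 / (N : ℝ))) := by
  obtain ⟨j, rfl⟩ := Nat.exists_eq_add_of_le' hj
  obtain ⟨C, hC, hCb⟩ := exists_norm_integral_exp_le j
  refine ⟨C * r ^ (-(1 / ((j + 2 : ℕ) : ℝ))), by positivity, fun ψ hψ u v huv hx n hn d => ?_⟩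
  have hn0 : (0 : ℝ) < n := by exact_mod_cast hn
  -- Chosen so that `t^j = n r`, a lower bound for the `j`-th derivative of the phase. The decay
  -- `n^{-1/j}` is then weakened to `n^{-1/N}`, using `n ≥ 1`.
  set t : ℝ := (n * r) ^ (((j + 2 : ℕ) : ℝ)⁻¹) with ht
  have htpos : 0 < t := by positivity
  have htj : t ^ (j + 2) = n * r := Real.rpow_inv_natCast_pow (by positivity) (by omega)
  have h1 := hCb (fun x => n * ψ x - d * x) (by fun_prop) u v t huv htpos fun x hx' => by
    have := iteratedDeriv_const_mul_sub_affine hψ n d 0 j x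
    simp only [sub_zero] at this
    rw [this, htj]
    exact mul_le_mul_of_nonneg_left (hx x hx') hn0.le
  refine h1.trans ?_
  have h2 : C / t = C * r ^ (-(1 / ((j + 2 : ℕ) : ℝ))) * (n : ℝ) ^ (-(1 / ((j + 2 : ℕ) : ℝ))) := by
    rw [ht, div_eq_mul_inv, ← Real.rpow_neg (by positivity), Real.mul_rpow hn0.le hr.le, one_div]
    ring
  rw [h2]
  refine mul_le_mul_of_nonneg_left ?_ (by positivity)
  refine Real.rpow_le_rpow_of_exponent_le (by exact_mod_cast hn) (neg_le_neg ?_)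
  exact one_div_le_one_div_of_le (by positivity) (by exact_mod_cast hjN)

theorem exists_norm_integral_phase_le {ψ : ℝ → ℝ} (hψ : ContDiff ℝ (⊤ : ℕ∞) ψ) {N : ℕ} {a b : ℝ}
    (hab : a ≤ b)
    (h : ∀ x ∈ Set.Icc a b, ∃ j, 2 ≤ j ∧ j ≤ N ∧ iteratedDeriv j ψ x ≠ 0) :
    ∃ C : ℝ, 0 ≤ C ∧ ∀ n : ℕ, 1 ≤ n → ∀ d : ℝ,
      ‖∫ x in a..b, Complex.exp (Complex.I * ((n * ψ x - d * x : ℝ) : ℂ))‖ ≤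
        C * (n : ℝ) ^ (-(1 / (N : ℝ))) := by
  -- The bound is required on every subinterval, so that it passes to the pieces of any subdivision
  -- subordinate to the cover.
  let good : Set ℝ → Prop := fun s => ∃ C : ℝ, 0 ≤ C ∧ ∀ u v : ℝ, u ≤ v → Set.Icc u v ⊆ s →
    ∀ n : ℕ, 1 ≤ n → ∀ d : ℝ,
      ‖∫ x in u..v, Complex.exp (Complex.I * ((n * ψ x - d * x : ℝ) : ℂ))‖ ≤
        C * (n : ℝ) ^ (-(1 / (N : ℝ)))
  have hcover : ∀ x ∈ Set.Icc a b, ∃ s, IsOpen s ∧ good s ∧ x ∈ s := by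
    intro x hx
    obtain ⟨j, hj, hjN, hj0⟩ := h x hx
    have hcont : Continuous (iteratedDeriv j ψ) :=
      (contDiff_infty.1 hψ j).continuous_iteratedDeriv j le_rfl
    rcases hj0.lt_or_gt with hlt | hgt
    · obtain ⟨C, hC, hCb⟩ := exists_norm_integral_phase_le_of_le hj hjN
        (r := -iteratedDeriv j ψ x / 2) (by linarith)
      refine ⟨{y | iteratedDeriv j ψ y < iteratedDeriv j ψ x / 2},
        isOpen_lt hcont continuous_const, ⟨C, hC, fun u v huv hs n hn d => ?_⟩,
        show iteratedDeriv j ψ x < iteratedDeriv j ψ x / 2 by linarith⟩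
      have := hCb (fun x => -ψ x) hψ.neg u v huv (fun y hy => by
        have : iteratedDeriv j ψ y < iteratedDeriv j ψ x / 2 := hs hy
        rw [iteratedDeriv_fun_neg]
        linarith) n hn (-d)
      rw [← norm_integral_exp_neg]
      convert! this using 6
      push_cast
      ring
    · obtain ⟨C, hC, hCb⟩ := exists_norm_integral_phase_le_of_le hj hjN
        (r := iteratedDeriv j ψ x / 2) (by linarith)
      refine ⟨{y | iteratedDeriv j ψ x / 2 < iteratedDeriv j ψ y},
        isOpen_lt continuous_const hcont, ⟨C, hC, fun u v huv hs => ?_⟩,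
        show iteratedDeriv j ψ x / 2 < iteratedDeriv j ψ x by linarith⟩
      exact hCb ψ hψ u v huv fun y hy => (hs hy : _ < _).le
  let ι := {s : Set ℝ // IsOpen s ∧ good s}
  obtain ⟨t, ht0, htm, ⟨M, hM⟩, ht⟩ := exists_monotone_Icc_subset_open_cover_Icc hab
    (c := fun i : ι => (Subtype.val ⁻¹' i.1 : Set (Set.Icc a b)))
    (fun i => i.2.1.preimage continuous_subtype_val) (fun x _ => by
      obtain ⟨s, hs, hg, hxs⟩ := hcover x.1 x.2
      exact Set.mem_iUnion.2 ⟨⟨s, hs, hg⟩, hxs⟩)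
  have hpiece : ∀ k, ∃ C : ℝ, 0 ≤ C ∧ ∀ n : ℕ, 1 ≤ n → ∀ d : ℝ,
      ‖∫ x in (t k : ℝ)..(t (k + 1) : ℝ),
        Complex.exp (Complex.I * ((n * ψ x - d * x : ℝ) : ℂ))‖ ≤
        C * (n : ℝ) ^ (-(1 / (N : ℝ))) := fun k => by
    obtain ⟨i, hi⟩ := ht k
    obtain ⟨C, hC, hCb⟩ := i.2.2
    refine ⟨C, hC, hCb _ _ (htm (Nat.le_succ k)) fun x hx => ?_⟩
    exact hi (a := ⟨x, (t k).2.1.trans hx.1, hx.2.trans (t (k + 1)).2.2⟩) ⟨hx.1, hx.2⟩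
  choose C hC hCb using hpiece
  refine ⟨∑ k ∈ Finset.range M, C k, Finset.sum_nonneg fun k _ => hC k, fun n hn d => ?_⟩
  have hcont : Continuous fun x => Complex.exp (Complex.I * ((n * ψ x - d * x : ℝ) : ℂ)) := by
    have := hψ.continuous
    fun_prop
  have hsum := intervalIntegral.sum_integral_adjacent_intervals (μ := MeasureTheory.volume)
    (a := fun k => (t k : ℝ)) (n := M) fun k _ => hcont.intervalIntegrable (t k) (t (k + 1))
  rw [ht0, hM M le_rfl] at hsum
  rw [← hsum, Finset.sum_mul]
  exact (norm_sum_le _ _).trans (Finset.sum_le_sum fun k _ => hCb k n hn d)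

/-! ### Taylor bound and Fejér weight -/

/-- Induction on `N` through the derivative and the mean value inequality. The factor `1/N!` is
given up. -/
theorem abs_le_mul_pow_of_iteratedDeriv_eq_zero {K ξ R : ℝ} {N : ℕ} {g : ℝ → ℝ}
    (hg : ContDiff ℝ (⊤ : ℕ∞) g) (h0 : ∀ j < N, iteratedDeriv j g ξ = 0)
    (hK : ∀ x ∈ Set.Icc (ξ - R) (ξ + R), |iteratedDeriv N g x| ≤ K) :
    ∀ x ∈ Set.Icc (ξ - R) (ξ + R), |g x| ≤ K * |x - ξ| ^ N := by
  induction N generalizing g with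
  | zero => intro x hx; simpa using hK x hx
  | succ N ih =>
    intro x hx
    have hd : Differentiable ℝ g := hg.differentiable (by simp)
    have hg' : ContDiff ℝ (⊤ : ℕ∞) (deriv g) := (contDiff_infty_iff_deriv.1 hg).2
    have hi := ih hg' (fun j hj => by rw [← iteratedDeriv_succ']; exact h0 _ (by omega))
      (fun y hy => by rw [← iteratedDeriv_succ']; exact hK y hy)
    have hK0 : 0 ≤ K := (abs_nonneg _).trans (hK x hx)
    have hR : 0 ≤ R := by linarith [hx.1, hx.2]
    have hξ : ξ ∈ Set.Icc (ξ - R) (ξ + R) := ⟨by linarith, by linarith⟩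
    have hsub : Set.uIcc ξ x ⊆ Set.Icc (ξ - R) (ξ + R) := Set.ordConnected_Icc.uIcc_subset hξ hx
    have hb := Convex.norm_image_sub_le_of_norm_deriv_le (f := g) (s := Set.uIcc ξ x) (x := ξ)
      (y := x) (C := K * |x - ξ| ^ N) (fun y _ => hd y)
      (fun y hy => (hi y (hsub hy)).trans (by
        have := Set.abs_sub_left_of_mem_uIcc hy
        gcongr))
      (convex_uIcc ξ x) Set.left_mem_uIcc Set.right_mem_uIcc
    have hg0 : g ξ = 0 := by simpa using h0 0 (by omega)
    rw [hg0, sub_zero, Real.norm_eq_abs, Real.norm_eq_abs] at hb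
    rw [pow_succ, ← mul_assoc]
    exact hb

/-- The squared modulus of the Dirichlet-type sum `∑_{p < M} e^{ipu}`. -/
noncomputable def fejerWeight (M : ℕ) (u : ℝ) : ℝ :=
  ‖∑ p ∈ Finset.range M, Complex.exp (Complex.I * u) ^ p‖ ^ 2

theorem continuous_fejerWeight (M : ℕ) : Continuous (fejerWeight M) := by
  unfold fejerWeight
  fun_prop

theorem fejerWeight_nonneg (M : ℕ) (u : ℝ) : 0 ≤ fejerWeight M u := sq_nonneg _

theorem ofReal_fejerWeight (M : ℕ) (u : ℝ) :
    (fejerWeight M u : ℂ) = ∑ p ∈ Finset.range M, ∑ q ∈ Finset.range M,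
      Complex.exp (Complex.I * (((p : ℤ) - (q : ℤ) : ℤ) : ℂ) * u) := by
  have h : (fejerWeight M u : ℂ) = (∑ p ∈ Finset.range M, Complex.exp (Complex.I * u) ^ p) *
      (starRingEnd ℂ) (∑ p ∈ Finset.range M, Complex.exp (Complex.I * u) ^ p) := by
    rw [Complex.mul_conj, Complex.normSq_eq_norm_sq, fejerWeight]
  rw [h, map_sum, Finset.sum_mul_sum]
  refine Finset.sum_congr rfl fun p _ => Finset.sum_congr rfl fun q _ => ?_
  rw [map_pow, ← Complex.exp_conj, ← Complex.exp_nat_mul, ← Complex.exp_nat_mul,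
    ← Complex.exp_add]
  congr 1
  simp
  ring

theorem integral_exp_I_mul_int (k : ℤ) :
    ∫ u in -Real.pi..Real.pi, Complex.exp (Complex.I * k * u) =
      if k = 0 then 2 * (Real.pi : ℂ) else 0 := by
  split_ifs with h
  · subst h
    simp
    ring
  · have hc : Complex.I * k ≠ 0 := mul_ne_zero Complex.I_ne_zero (by exact_mod_cast h)
    rw [integral_exp_mul_complex hc, div_eq_zero_iff]
    left
    rw [sub_eq_zero, Complex.exp_eq_exp_iff_exists_int]
    exact ⟨k, by push_cast; ring⟩

theorem integral_fejerWeight (M : ℕ) :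
    ∫ u in -Real.pi..Real.pi, fejerWeight M u = 2 * Real.pi * M := by
  have h : ((∫ u in -Real.pi..Real.pi, fejerWeight M u : ℝ) : ℂ) = 2 * Real.pi * M := by
    rw [← intervalIntegral.integral_ofReal]
    simp_rw [ofReal_fejerWeight]
    have hc : ∀ k : ℤ, IntervalIntegrable (fun u : ℝ => Complex.exp (Complex.I * k * u))
        MeasureTheory.volume (-Real.pi) Real.pi := fun k =>
      Continuous.intervalIntegrable (by fun_prop) _ _
    rw [intervalIntegral.integral_finsetSum]
    swap
    · exact fun p _ => Continuous.intervalIntegrable (by fun_prop) _ _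
    simp_rw [intervalIntegral.integral_finsetSum fun q _ => hc _, integral_exp_I_mul_int]
    have : ∀ p ∈ Finset.range M, (∑ q ∈ Finset.range M,
        if ((p : ℤ) - (q : ℤ) : ℤ) = 0 then 2 * (Real.pi : ℂ) else 0) = 2 * Real.pi := by
      intro p hp
      rw [Finset.sum_eq_single_of_mem p hp fun q _ hq => if_neg (by omega), if_pos (by omega)]
    rw [Finset.sum_congr rfl this]
    simp
    ring
  exact_mod_cast h

/-- The geometric sum times `z - 1` has norm at most `2`, while `|z - 1| = 2|sin(u/2)| ≥ 2|u|/π`. -/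
theorem fejerWeight_mul_sq_le (M : ℕ) {u : ℝ} (hu : |u| ≤ Real.pi) :
    fejerWeight M u * u ^ 2 ≤ Real.pi ^ 2 := by
  set z := Complex.exp (Complex.I * u) with hz
  have hz1 : ‖z‖ = 1 := by rw [hz, mul_comm, Complex.norm_exp_ofReal_mul_I]
  have h1 : ‖∑ p ∈ Finset.range M, z ^ p‖ * ‖z - 1‖ ≤ 2 := by
    rw [← norm_mul, geom_sum_mul]
    refine (norm_sub_le _ _).trans ?_
    rw [norm_pow, hz1, one_pow, norm_one]
    norm_num
  have h2 : 2 * |u| ≤ Real.pi * ‖z - 1‖ := by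
    have h3 : ‖z - 1‖ = ‖2 * Real.sin (u / 2)‖ := Complex.norm_exp_I_mul_ofReal_sub_one u
    rw [h3, Real.norm_eq_abs, abs_mul, abs_two]
    have h4 := Real.mul_le_sin (x := |u| / 2) (by positivity) (by linarith)
    have h5 : Real.sin (|u| / 2) ≤ |Real.sin (u / 2)| := by
      rcases abs_cases u with h | h
      · rw [h.1]; exact le_abs_self _
      · rw [h.1, neg_div, Real.sin_neg]; exact neg_le_abs _
    have h6 : Real.pi * (2 / Real.pi * (|u| / 2)) = |u| := by
      field_simp
    nlinarith [mul_le_mul_of_nonneg_left (h4.trans h5) Real.pi_pos.le]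
  have h7 : ‖∑ p ∈ Finset.range M, z ^ p‖ * |u| ≤ Real.pi := by
    have := mul_le_mul_of_nonneg_left h2 (norm_nonneg (∑ p ∈ Finset.range M, z ^ p))
    nlinarith [mul_le_mul_of_nonneg_left h1 Real.pi_pos.le]
  have h8 := pow_le_pow_left₀ (by positivity) h7 2
  rw [mul_pow, sq_abs] at h8
  exact h8

theorem integral_inv_sq_add_sq_le {δ : ℝ} (hδ : 0 < δ) (b : ℝ) :
    ∫ u in -b..b, 1 / (u ^ 2 + δ ^ 2) ≤ Real.pi / δ := by
  have hd : ∀ u ∈ Set.uIcc (-b) b,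
      HasDerivAt (fun u => δ⁻¹ * Real.arctan (u / δ)) (1 / (u ^ 2 + δ ^ 2)) u := fun u _ => by
    refine (((hasDerivAt_id u).div_const δ).arctan.const_mul δ⁻¹).congr_deriv ?_
    simp only [id]
    field_simp
    ring
  have hc : Continuous fun u : ℝ => 1 / (u ^ 2 + δ ^ 2) :=
    continuous_const.div (by fun_prop) fun u => by positivity
  rw [intervalIntegral.integral_eq_sub_of_hasDerivAt hd (hc.intervalIntegrable _ _), neg_div,
    Real.arctan_neg]
  have := Real.arctan_lt_pi_div_two (b / δ)
  rw [div_eq_mul_inv Real.pi]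
  nlinarith [inv_pos.2 hδ]

/-- After rotation by `e^{-ic}` the real part has integrand `cos(f u - c)` times the weight. The
cosine is at least `1/2` on the window and at least `-1` outside, where the deficit of `3/2` times
the weight is at most `3π²/(u² + δ²)`. In total this is at least `πM - 3π³/δ`, and `6π² ≤ δM` makes
the loss at most `πM/2`. -/
theorem le_norm_integral_exp_mul_fejerWeight {f : ℝ → ℝ} (hf : Continuous f) {c δ : ℝ}
    (hδ : 0 < δ) (h : ∀ u, |u| ≤ δ → |f u - c| ≤ 1) {M : ℕ} (hM : 6 * Real.pi ^ 2 ≤ δ * M) :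
    Real.pi * M / 2 ≤
      ‖∫ u in -Real.pi..Real.pi, Complex.exp (Complex.I * f u) * fejerWeight M u‖ := by
  have hpi := Real.pi_pos
  have hW := continuous_fejerWeight M
  have hcT : Continuous fun u : ℝ => 1 / (u ^ 2 + δ ^ 2) :=
    continuous_const.div (by fun_prop) fun u => by positivity
  have hpt : ∀ u ∈ Set.Icc (-Real.pi) Real.pi,
      fejerWeight M u * (1 / 2) - 3 * Real.pi ^ 2 * (1 / (u ^ 2 + δ ^ 2)) ≤
        Real.cos (f u - c) * fejerWeight M u := by
    intro u hu
    have hW0 := fejerWeight_nonneg M u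
    have hT0 : 0 ≤ 3 * Real.pi ^ 2 * (1 / (u ^ 2 + δ ^ 2)) := by positivity
    rcases le_total |u| δ with hle | hle
    · have h1 : 1 / 2 ≤ Real.cos (f u - c) := by
        have h2 := (sq_le_one_iff_abs_le_one _).2 (h u hle)
        linarith [Real.one_sub_sq_div_two_le_cos (x := f u - c)]
      nlinarith
    · have h1 := fejerWeight_mul_sq_le M (abs_le.2 hu)
      have h2 : δ ^ 2 ≤ u ^ 2 := by
        rw [← sq_abs u]
        exact pow_le_pow_left₀ hδ.le hle 2
      have h3 : fejerWeight M u * (3 / 2) ≤ 3 * Real.pi ^ 2 * (1 / (u ^ 2 + δ ^ 2)) := by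
        rw [mul_one_div, le_div_iff₀ (by positivity)]
        nlinarith
      nlinarith [Real.neg_one_le_cos (f u - c)]
  have hint := intervalIntegral.integral_mono_on (μ := MeasureTheory.volume)
    (by linarith : -Real.pi ≤ Real.pi)
    (Continuous.intervalIntegrable (by fun_prop) _ _)
    (Continuous.intervalIntegrable (by fun_prop) _ _) hpt
  rw [intervalIntegral.integral_sub (Continuous.intervalIntegrable (by fun_prop) _ _)
    (Continuous.intervalIntegrable (by fun_prop) _ _), intervalIntegral.integral_mul_const,
    intervalIntegral.integral_const_mul, integral_fejerWeight] at hint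
  have h1 := mul_le_mul_of_nonneg_left (integral_inv_sq_add_sq_le hδ Real.pi)
    (by positivity : 0 ≤ 3 * Real.pi ^ 2)
  have h2 : 3 * Real.pi ^ 2 * (Real.pi / δ) ≤ Real.pi * M / 2 := by
    rw [← mul_div_assoc, div_le_iff₀ hδ]
    nlinarith
  have hre : (Complex.exp (-(Complex.I * c)) *
      ∫ u in -Real.pi..Real.pi, Complex.exp (Complex.I * f u) * fejerWeight M u).re =
      ∫ u in -Real.pi..Real.pi, Real.cos (f u - c) * fejerWeight M u := by
    rw [← intervalIntegral.integral_const_mul]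
    have := Complex.reCLM.intervalIntegral_comp_comm (μ := MeasureTheory.volume)
      (a := -Real.pi) (b := Real.pi)
      (f := fun u => Complex.exp (-(Complex.I * c)) *
        (Complex.exp (Complex.I * f u) * fejerWeight M u))
      (Continuous.intervalIntegrable (by fun_prop) _ _)
    rw [Complex.reCLM_apply] at this
    rw [← this]
    refine intervalIntegral.integral_congr fun u _ => ?_
    simp only [Complex.reCLM_apply]
    rw [← mul_assoc, ← Complex.exp_add, Complex.re_mul_ofReal,
      show -(Complex.I * c) + Complex.I * f u = ((f u - c : ℝ) : ℂ) * Complex.I by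
        push_cast; ring, Complex.exp_ofReal_mul_I_re]
  have hle := Complex.re_le_norm (Complex.exp (-(Complex.I * c)) *
      ∫ u in -Real.pi..Real.pi, Complex.exp (Complex.I * f u) * fejerWeight M u)
  rw [hre, norm_mul, show -(Complex.I * (c : ℂ)) = ((-c : ℝ) : ℂ) * Complex.I by
    push_cast; ring, Complex.norm_exp_ofReal_mul_I, one_mul] at hle
  linarith

/-- Testing against a modulated and translated Fejér kernel bounds an integral by Fourier
coefficients. -/
theorem norm_integral_mul_fejerWeight_le {F : ℝ → ℂ} (hF : Continuous F)
    (hper : Function.Periodic F (2 * Real.pi)) {S : ℝ}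
    (hS : ∀ k : ℤ, ‖∫ θ in (0 : ℝ)..(2 * Real.pi), F θ * Complex.exp (-(Complex.I * k * θ))‖ ≤ S)
    (ξ : ℝ) (k : ℤ) (M : ℕ) :
    ‖∫ u in -Real.pi..Real.pi,
      F (u + ξ) * Complex.exp (-(Complex.I * k * (u + ξ : ℝ))) * fejerWeight M u‖ ≤
        (M : ℝ) ^ 2 * S := by
  have hshift : ∀ l : ℤ, ∫ u in -Real.pi..Real.pi,
      F (u + ξ) * Complex.exp (-(Complex.I * l * (u + ξ : ℝ))) =
      ∫ θ in (0 : ℝ)..(2 * Real.pi), F θ * Complex.exp (-(Complex.I * l * θ)) := fun l => by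
    have hp : Function.Periodic (fun θ : ℝ => F θ * Complex.exp (-(Complex.I * l * θ)))
        (2 * Real.pi) := fun θ => by
      simp only
      rw [hper θ]
      congr 1
      rw [Complex.exp_eq_exp_iff_exists_int]
      exact ⟨-l, by push_cast; ring⟩
    rw [intervalIntegral.integral_comp_add_right
      (fun θ : ℝ => F θ * Complex.exp (-(Complex.I * l * θ)))]
    have := hp.intervalIntegral_add_eq (-Real.pi + ξ) 0
    rw [zero_add] at this
    rw [← this]
    congr 1
    ring
  -- The `(p, q)` term of the weight only shifts the frequency from `k` to `k - (p - q)`, up to a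
  -- unimodular constant.
  have hterm : ∀ u : ℝ, F (u + ξ) * Complex.exp (-(Complex.I * k * (u + ξ : ℝ))) *
      fejerWeight M u = ∑ p ∈ Finset.range M, ∑ q ∈ Finset.range M,
        Complex.exp (-(Complex.I * ((p : ℤ) - (q : ℤ) : ℤ) * ξ)) *
        (F (u + ξ) * Complex.exp
          (-(Complex.I * (k - ((p : ℤ) - (q : ℤ)) : ℤ) * (u + ξ : ℝ)))) := fun u => by
    rw [ofReal_fejerWeight, Finset.mul_sum]
    refine Finset.sum_congr rfl fun p _ => ?_
    rw [Finset.mul_sum]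
    refine Finset.sum_congr rfl fun q _ => ?_
    have : Complex.exp (-(Complex.I * k * (u + ξ : ℝ))) *
        Complex.exp (Complex.I * ((p : ℤ) - (q : ℤ) : ℤ) * u) =
        Complex.exp (-(Complex.I * ((p : ℤ) - (q : ℤ) : ℤ) * ξ)) *
        Complex.exp (-(Complex.I * (k - ((p : ℤ) - (q : ℤ)) : ℤ) * (u + ξ : ℝ))) := by
      rw [← Complex.exp_add, ← Complex.exp_add]
      congr 1
      push_cast
      ring
    linear_combination F (u + ξ) * this
  simp_rw [hterm]
  have hc : ∀ p q : ℕ, IntervalIntegrable (fun u : ℝ =>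
      Complex.exp (-(Complex.I * ((p : ℤ) - (q : ℤ) : ℤ) * ξ)) *
        (F (u + ξ) * Complex.exp
          (-(Complex.I * (k - ((p : ℤ) - (q : ℤ)) : ℤ) * (u + ξ : ℝ)))))
      MeasureTheory.volume (-Real.pi) Real.pi := fun p q =>
    Continuous.intervalIntegrable (by fun_prop) _ _
  rw [intervalIntegral.integral_finsetSum]
  swap
  · exact fun p _ => Continuous.intervalIntegrable (by fun_prop) _ _
  have hpq : ∀ p q : ℕ, ‖∫ u in -Real.pi..Real.pi,
      Complex.exp (-(Complex.I * ((p : ℤ) - (q : ℤ) : ℤ) * ξ)) *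
        (F (u + ξ) * Complex.exp
          (-(Complex.I * (k - ((p : ℤ) - (q : ℤ)) : ℤ) * (u + ξ : ℝ))))‖ ≤ S := fun p q => by
    rw [intervalIntegral.integral_const_mul, hshift, norm_mul,
      show -(Complex.I * (((p : ℤ) - (q : ℤ) : ℤ) : ℂ) * ξ) =
        ((-(((p : ℤ) - (q : ℤ) : ℤ) * ξ) : ℝ) : ℂ) * Complex.I by push_cast; ring,
      Complex.norm_exp_ofReal_mul_I, one_mul]
    exact hS _
  refine (norm_sum_le _ _).trans ((Finset.sum_le_card_nsmul _ _ (M * S) fun p _ => ?_).trans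
    (le_of_eq ?_))
  · rw [intervalIntegral.integral_finsetSum fun q _ => hc p q]
    refine (norm_sum_le _ _).trans ((Finset.sum_le_card_nsmul _ _ S fun q _ => hpq p q).trans
      (le_of_eq ?_))
    rw [Finset.card_range, nsmul_eq_mul]
  · rw [Finset.card_range, nsmul_eq_mul]
    ring

/-! ### Vanishing of the negative frequencies -/

theorem differentiableOn_blaschkeProduct {m : ℕ} (γ : ℂ) {a : Fin m → ℂ}
    (ha : ∀ j, ‖a j‖ < 1) : DifferentiableOn ℂ (blaschkeProduct γ a) (Metric.closedBall 0 1) := by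
  unfold blaschkeProduct blaschkeFactor
  refine DifferentiableOn.const_mul (DifferentiableOn.fun_finsetProd fun j _ => ?_) _
  refine DifferentiableOn.div (by fun_prop) (by fun_prop) fun z hz => ?_
  refine Complex.slitPlane_ne_zero (one_sub_mem_slitPlane ?_)
  rw [norm_mul, RCLike.norm_conj]
  exact mul_lt_one_of_nonneg_of_lt_one_left (norm_nonneg _) (ha j) (by simpa using hz)

/-- Cauchy's theorem for `z^p f(z)`; the extra power comes from `dz = i z dθ`. -/
theorem integral_exp_mul_eq_zero_of_differentiableOn {f : ℂ → ℂ}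
    (hf : DifferentiableOn ℂ f (Metric.closedBall 0 1)) (p : ℕ) :
    ∫ θ in (0 : ℝ)..(2 * Real.pi),
      f (Complex.exp (Complex.I * θ)) * Complex.exp (Complex.I * (p + 1 : ℕ) * θ) = 0 := by
  have h := DiffContOnCl.circleIntegral_eq_zero zero_le_one (f := fun z => z ^ p * f z) (c := 0)
    (((differentiableOn_id.pow p).mul hf).diffContOnCl_ball subset_rfl)
  rw [circleIntegral] at h
  have h2 : ∫ θ in (0 : ℝ)..(2 * Real.pi), Complex.I *
      (f (Complex.exp (Complex.I * θ)) * Complex.exp (Complex.I * (p + 1 : ℕ) * θ)) = 0 := by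
    rw [← h]
    refine intervalIntegral.integral_congr fun θ _ => ?_
    simp only [deriv_circleMap, circleMap_zero, Complex.ofReal_one, one_mul, smul_eq_mul]
    rw [show Complex.I * ((p + 1 : ℕ) : ℂ) * θ = ((p + 1 : ℕ) : ℂ) * (θ * Complex.I) by ring,
      Complex.exp_nat_mul, mul_comm Complex.I (θ : ℂ)]
    ring
  rw [intervalIntegral.integral_const_mul] at h2
  exact (mul_eq_zero.1 h2).resolve_left Complex.I_ne_zero

/-! ### Lower bound at a flattest point -/

theorem exists_le_norm_integral_phase {ψ : ℝ → ℝ} (hψ : ContDiff ℝ (⊤ : ℕ∞) ψ) {ξ : ℝ} {N : ℕ}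
    (hN : 2 ≤ N) (h0 : ∀ j, 2 ≤ j → j < N → iteratedDeriv j ψ ξ = 0) :
    ∃ c : ℝ, 0 < c ∧ ∀ n : ℕ, 1 ≤ n → ∃ (k : ℤ) (M : ℕ), 0 < M ∧
      c * (n : ℝ) ^ (-(1 / (N : ℝ))) * (M : ℝ) ^ 2 ≤
        ‖∫ u in -Real.pi..Real.pi,
          Complex.exp (Complex.I * ((n * ψ (u + ξ) - k * (u + ξ) : ℝ) : ℂ)) * fejerWeight M u‖ := by
  have hpi3 := Real.pi_gt_three
  -- `ψ` minus its tangent line at `ξ`; all derivatives of order below `N` vanish there.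
  set g : ℝ → ℝ := fun x => 1 * ψ x - deriv ψ ξ * x - (ψ ξ - deriv ψ ξ * ξ) with hg
  have hgc : ContDiff ℝ (⊤ : ℕ∞) g := by fun_prop
  have hg0 : ∀ j < N, iteratedDeriv j g ξ = 0 := fun j hj => by
    match j, hj with
    | 0, _ => simp [hg]
    | 1, _ =>
      have hx := (hψ.differentiable (by simp) ξ).hasDerivAt
      rw [iteratedDeriv_one]
      simpa [hg] using (((hx.const_mul 1).fun_sub
        ((hasDerivAt_id ξ).const_mul (deriv ψ ξ))).sub_const (ψ ξ - deriv ψ ξ * ξ)).deriv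
    | j + 2, hj =>
      rw [hg, iteratedDeriv_const_mul_sub_affine hψ, h0 (j + 2) (by omega) hj, mul_zero]
  obtain ⟨K, hK⟩ := (isCompact_Icc (a := ξ - 1) (b := ξ + 1)).exists_bound_of_continuousOn
    ((contDiff_infty.1 hgc N).continuous_iteratedDeriv N le_rfl).continuousOn
  have hK0 : 0 ≤ K := (norm_nonneg _).trans (hK ξ ⟨by linarith, by linarith⟩)
  have hgb := abs_le_mul_pow_of_iteratedDeriv_eq_zero hgc hg0 hK
  -- With `δ = ε n^{-1/N}`, the Taylor error is at most `Kε` and rounding `nψ'(ξ)` costs at most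
  -- `ε`. This choice makes the sum exactly `1`.
  set ε : ℝ := 1 / (1 + K) with hε
  have hεpos : 0 < ε := by positivity
  have hε1 : ε ≤ 1 := by rw [hε, div_le_one (by positivity)]; linarith
  have hεK : ε + K * ε = 1 := by rw [hε]; field_simp
  -- The number `61` bounds `δM ≤ 6π² + δ`, since `δ ≤ 1`.
  refine ⟨ε / 61, by positivity, fun n hn => ?_⟩
  have hn0 : (0 : ℝ) < n := by exact_mod_cast hn
  have hn1 : (1 : ℝ) ≤ n := by exact_mod_cast hn
  set ρ : ℝ := (n : ℝ) ^ (-(1 / (N : ℝ))) with hρ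
  have hρpos : 0 < ρ := by positivity
  have hρ1 : ρ ≤ 1 := Real.rpow_le_one_of_one_le_of_nonpos hn1 (by
    have : 0 ≤ 1 / (N : ℝ) := by positivity
    linarith)
  have hρN : n * ρ ^ N = 1 := by
    rw [hρ, Real.rpow_neg hn0.le, inv_pow, one_div, Real.rpow_inv_natCast_pow hn0.le (by omega)]
    exact mul_inv_cancel₀ hn0.ne'
  set δ := ε * ρ with hδ
  have hδpos : 0 < δ := by positivity
  have hδε : δ ≤ ε := mul_le_of_le_one_right hεpos.le hρ1
  have hδ1 : δ ≤ 1 := hδε.trans hε1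
  have hnδ : n * δ ^ N ≤ ε := by
    rw [hδ, mul_pow, mul_left_comm, hρN, mul_one]
    exact pow_le_of_le_one hεpos.le hε1 (by omega)
  set M := ⌈6 * Real.pi ^ 2 / δ⌉₊ with hMdef
  have hM1 : 6 * Real.pi ^ 2 ≤ δ * M := by
    have := (div_le_iff₀ hδpos).1 (Nat.le_ceil (6 * Real.pi ^ 2 / δ))
    linarith
  have hM0 : 0 < M := Nat.ceil_pos.2 (by positivity)
  have hM2 : δ * M ≤ 61 := by
    have h1 := (Nat.ceil_lt_add_one (by positivity : 0 ≤ 6 * Real.pi ^ 2 / δ)).le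
    have h2 := mul_le_mul_of_nonneg_left h1 hδpos.le
    have h3 : δ * (6 * Real.pi ^ 2 / δ + 1) = 6 * Real.pi ^ 2 + δ := by field_simp
    have h4 := Real.pi_lt_d2
    nlinarith
  refine ⟨round (n * deriv ψ ξ), M, hM0, ?_⟩
  set k := round (n * deriv ψ ξ) with hk
  have hψc := hψ.continuous
  have hmain := le_norm_integral_exp_mul_fejerWeight
    (f := fun u => n * ψ (u + ξ) - k * (u + ξ)) (by fun_prop) (c := n * ψ ξ - k * ξ) hδpos
    (fun u hu => by
      have h1 := hgb (u + ξ) (by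
        have := abs_le.1 hu
        exact ⟨by linarith, by linarith⟩)
      rw [add_sub_cancel_right] at h1
      have h2 : |u| ^ N ≤ δ ^ N := pow_le_pow_left₀ (abs_nonneg _) hu N
      have h3 : n * |g (u + ξ)| ≤ K * ε := by
        calc n * |g (u + ξ)| ≤ n * (K * δ ^ N) :=
              mul_le_mul_of_nonneg_left (h1.trans (mul_le_mul_of_nonneg_left h2 hK0)) hn0.le
          _ = K * (n * δ ^ N) := by ring
          _ ≤ K * ε := mul_le_mul_of_nonneg_left hnδ hK0
      have h4 : |(n * deriv ψ ξ - k) * u| ≤ ε := by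
        rw [abs_mul]
        have h5 := abs_sub_round (n * deriv ψ ξ)
        rw [← hk] at h5
        nlinarith [abs_nonneg u, abs_nonneg (n * deriv ψ ξ - k)]
      have h6 : n * ψ (u + ξ) - k * (u + ξ) - (n * ψ ξ - k * ξ) =
          n * g (u + ξ) + (n * deriv ψ ξ - k) * u := by
        simp only [hg]
        ring
      rw [h6]
      refine (abs_add_le _ _).trans ?_
      rw [abs_mul, abs_of_pos hn0]
      linarith) hM1
  refine le_trans ?_ hmain
  have hMR : (0 : ℝ) < M := by exact_mod_cast hM0
  have h7 : ε / 61 * ρ * (M : ℝ) ^ 2 = (δ * M) * M / 61 := by rw [hδ]; ring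
  rw [h7]
  nlinarith

/-! ### Assembly of the two bounds -/

theorem norm_circleFourierCoeff (f : ℂ → ℂ) (k : ℕ) :
    2 * Real.pi * ‖circleFourierCoeff f k‖ = ‖∫ θ in (0 : ℝ)..(2 * Real.pi),
      f (Complex.exp (Complex.I * θ)) * Complex.exp (-(Complex.I * k * θ))‖ := by
  have hpi := Real.pi_pos
  rw [circleFourierCoeff, norm_mul, ← mul_assoc]
  have : ‖1 / (2 * (Real.pi : ℂ))‖ = 1 / (2 * Real.pi) := by
    rw [norm_div, norm_one, norm_mul, Complex.norm_real, Complex.norm_ofNat, Real.norm_eq_abs,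
      abs_of_pos hpi]
  rw [this, mul_one_div_cancel (by positivity), one_mul]

theorem IsContinuousArgument.integrand_eq {f : ℂ → ℂ} {ψ : ℝ → ℝ} (hψ : IsContinuousArgument f ψ)
    (n : ℕ) (k : ℂ) (d : ℝ) (hk : k = d) (θ : ℝ) :
    f (Complex.exp (Complex.I * θ)) ^ n * Complex.exp (-(Complex.I * k * θ)) =
      Complex.exp (Complex.I * ((n * ψ θ - d * θ : ℝ) : ℂ)) := by
  rw [hψ.2, ← Complex.exp_nat_mul, ← Complex.exp_add, hk]
  congr 1
  push_cast
  ring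

theorem norm_integral_le_fourierSupNorm {f : ℂ → ℂ}
    (hf : DifferentiableOn ℂ f (Metric.closedBall 0 1))
    (hb : BddAbove (Set.range fun k : ℕ => ‖circleFourierCoeff f k‖)) (k : ℤ) :
    ‖∫ θ in (0 : ℝ)..(2 * Real.pi),
      f (Complex.exp (Complex.I * θ)) * Complex.exp (-(Complex.I * k * θ))‖ ≤
        2 * Real.pi * fourierSupNorm f := by
  have hpi := Real.pi_pos
  have hle : ∀ k : ℕ, ‖circleFourierCoeff f k‖ ≤ fourierSupNorm f := fun k => le_ciSup hb k
  rcases lt_or_ge k 0 with hk | hk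
  · obtain ⟨p, rfl⟩ := Int.eq_negSucc_of_lt_zero hk
    have h := integral_exp_mul_eq_zero_of_differentiableOn hf p
    have h2 : ∀ θ : ℝ, -(Complex.I * ((Int.negSucc p : ℤ) : ℂ) * θ) =
        Complex.I * (p + 1 : ℕ) * θ := fun θ => by
      rw [Int.cast_negSucc]
      ring
    simp_rw [h2]
    rw [h, norm_zero]
    have := (norm_nonneg _).trans (hle 0)
    positivity
  · lift k to ℕ using hk
    have := norm_circleFourierCoeff f k
    simp only [Int.cast_natCast]
    rw [← this]
    exact mul_le_mul_of_nonneg_left (hle k) (by positivity)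

theorem IsInflectionData.fourierSupNorm_bounds {m : ℕ} {γ : ℂ} (hγ : ‖γ‖ = 1) {a : Fin m → ℂ}
    (ha : ∀ j, ‖a j‖ < 1) {ψ : ℝ → ℝ} (hψ : IsContinuousArgument (blaschkeProduct γ a) ψ)
    {s : ℕ} {ξ : Fin s → ℝ} {N : Fin s → ℕ} (h : IsInflectionData ψ ξ N) {M : ℕ}
    (hM : ∀ l, N l ≤ M) {l : Fin s} (hl : N l = M) :
    ∃ c C : ℝ, 0 < c ∧ 0 < C ∧ ∀ n : ℕ, 1 ≤ n →
      c * (n : ℝ) ^ (-(1 / (M : ℝ))) ≤ fourierSupNorm (fun z => blaschkeProduct γ a z ^ n) ∧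
      fourierSupNorm (fun z => blaschkeProduct γ a z ^ n) ≤ C * (n : ℝ) ^ (-(1 / (M : ℝ))) := by
  have hpi := Real.pi_pos
  have hC : ContDiff ℝ (⊤ : ℕ∞) ψ := (hψ.analyticOnNhd hγ ha).contDiff
  have hM2 : 2 ≤ M := by have := h.three_le l; omega
  obtain ⟨C, hC0, hCb⟩ := exists_norm_integral_phase_le hC Real.two_pi_pos.le
    (h.exists_ne_zero (hψ.add_two_pi hγ ha) hM2 hM)
  obtain ⟨c, hc0, hcb⟩ := exists_le_norm_integral_phase hC hM2 (ξ := ξ l)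
    fun j hj hjM => h.vanish l j hj (hl ▸ hjM)
  -- `C` is only known to be nonnegative; `C + 1` makes the upper constant positive.
  refine ⟨c / (2 * Real.pi), (C + 1) / (2 * Real.pi), by positivity, by positivity,
    fun n hn => ?_⟩
  set F : ℂ → ℂ := fun z => blaschkeProduct γ a z ^ n with hF
  have hn0 : (0 : ℝ) < n := by exact_mod_cast hn
  have hρ : 0 < (n : ℝ) ^ (-(1 / (M : ℝ))) := by positivity
  have hcoeff : ∀ k : ℕ, ‖circleFourierCoeff F k‖ ≤
      (C + 1) / (2 * Real.pi) * (n : ℝ) ^ (-(1 / (M : ℝ))) := fun k => by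
    have h1 := norm_circleFourierCoeff F k
    simp only [hF] at h1
    simp_rw [hψ.integrand_eq n k k (by simp)] at h1
    have h2 := hCb n hn k
    rw [div_mul_eq_mul_div, le_div_iff₀ (by positivity)]
    linarith
  have hbdd : BddAbove (Set.range fun k : ℕ => ‖circleFourierCoeff F k‖) :=
    ⟨_, Set.forall_mem_range.2 hcoeff⟩
  refine ⟨?_, ciSup_le hcoeff⟩
  obtain ⟨k, L, hL, hkL⟩ := hcb n hn
  have hper : Function.Periodic (fun θ : ℝ => F (Complex.exp (Complex.I * θ))) (2 * Real.pi) :=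
    fun θ => by
      simp only
      rw [exp_I_mul_add_two_pi]
  have hcont : Continuous fun θ : ℝ => F (Complex.exp (Complex.I * θ)) := by
    simp only [hF, hψ.2]
    have := hC.continuous
    fun_prop
  have hup := norm_integral_mul_fejerWeight_le hcont hper
    (norm_integral_le_fourierSupNorm ((differentiableOn_blaschkeProduct γ ha).pow n) hbdd)
    (ξ l) k L
  simp only [hF] at hup
  simp_rw [hψ.integrand_eq n k k (by simp)] at hup
  have hfin := hkL.trans hup
  have hL2 : (0 : ℝ) < (L : ℝ) ^ 2 := by positivity
  rw [mul_comm] at hfin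
  have := le_of_mul_le_mul_left hfin hL2
  rw [div_mul_eq_mul_div, div_le_iff₀ (by positivity)]
  linarith

theorem theorem1 {m : ℕ} (γ : ℂ) (hγ : ‖γ‖ = 1) (a : Fin m → ℂ) (ha : ∀ j, ‖a j‖ < 1)
    (ha0 : ∃ j, a j ≠ 0) :
    (∃ ψ : ℝ → ℝ, IsContinuousArgument (blaschkeProduct γ a) ψ) ∧
    ∀ ψ : ℝ → ℝ, IsContinuousArgument (blaschkeProduct γ a) ψ →
      (∃ (s : ℕ) (ξ : Fin s → ℝ) (N : Fin s → ℕ), IsInflectionData ψ ξ N) ∧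
      ∀ (s : ℕ) (ξ : Fin s → ℝ) (N : Fin s → ℕ), IsInflectionData ψ ξ N →
        0 < s ∧ 3 ≤ Finset.univ.sup N ∧
        ∃ c C : ℝ, 0 < c ∧ 0 < C ∧ ∀ n : ℕ, 1 ≤ n →
          c * (n : ℝ) ^ (-(1 / ((Finset.univ.sup N : ℕ) : ℝ))) ≤
              fourierSupNorm (fun z => blaschkeProduct γ a z ^ n) ∧
            fourierSupNorm (fun z => blaschkeProduct γ a z ^ n) ≤
              C * (n : ℝ) ^ (-(1 / ((Finset.univ.sup N : ℕ) : ℝ))) := by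
  refine ⟨⟨blaschkeArgument γ a, continuous_iff_continuousAt.2 fun θ =>
    (analyticAt_blaschkeArgument γ ha θ).continuousAt, exp_blaschkeArgument hγ ha⟩,
    fun ψ hψ => ?_⟩
  have hA := hψ.analyticOnNhd hγ ha
  refine ⟨exists_isInflectionData hA (hψ.exists_iteratedDeriv_two_ne_zero hγ ha ha0),
    fun s ξ N h => ?_⟩
  have hs := h.pos hA.contDiff (hψ.add_two_pi hγ ha)
  have hle : ∀ l, N l ≤ Finset.univ.sup N := fun l => Finset.le_sup (Finset.mem_univ l)
  obtain ⟨l, -, hl⟩ := Finset.exists_mem_eq_sup Finset.univ ⟨⟨0, hs⟩, Finset.mem_univ _⟩ N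
  exact ⟨hs, (h.three_le l).trans (hle l), h.fourierSupNorm_bounds hγ ha hψ hle hl.symm⟩
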